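/- Let $f:[0,\infty)\to J$ be continuous, where $J\subseteq\mathbb R$ is an interval containing $0$, and let $g:J\to\mathbb R$ be strictly increasing and concave on $J$ such that $g\circ f$ is convex on $[0,\infty)$ (that is, $f$ is $g$-convex on $[0,\infty)$). Assume $(g\circ f)(0)\le 0$ and $g(0)\ge 0$. Let $A,B\in\mathcal M_n$ be positive semidefinite complex $n\times n$ matrices such that $f\ge 0$ on the spectra of $A$ and $B$ (for instance, $f\geq 0$ on $[0,\infty)$), and let $\|\cdot\|$ be a unitarily invariant norm on $\mathcal M_n$. Then the spectrum of $(g\circ f)(A)+(g\circ f)(B)$ is contained in $g(J)$, the domain of $g^{-1}$, and $$\|f(A)+f(B)\|\le\left\|g^{-1}\big((g\circ f)(A)+(g\circ f)(B)\big)\right\|\le\|f(A+B)\|.$$ -/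

import Mathlib

open scoped ComplexOrder

/-- `f` is `g`-convex on the interval `J₁`, where `g` is given on the interval `J₂`:
`f : J₁ → J₂` is continuous, `g` is (strictly) increasing and concave on `J₂`, and `g ∘ f` is
convex on `J₁`.  That `J₁` and `J₂` are intervals is part of `ConvexOn` and `ConcaveOn`;
strictness is what makes the inverse of `g` exist. -/
structure GConvexOn (J₁ J₂ : Set ℝ) (g f : ℝ → ℝ) : Prop where
  continuousOn : ContinuousOn f J₁
  mapsTo : Set.MapsTo f J₁ J₂
  strictMonoOn : StrictMonoOn g J₂
  concaveOn : ConcaveOn ℝ J₂ g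
  convexOn : ConvexOn ℝ J₁ (g ∘ f)

/-- A seminorm on the complex `n × n` matrices is a unitarily invariant norm if it is definite and
`‖U A V‖ = ‖A‖` for all unitary `U` and `V`. -/
structure IsUnitarilyInvariantNorm {n : ℕ} (N : Seminorm ℂ (Matrix (Fin n) (Fin n) ℂ)) : Prop where
  eq_zero : ∀ A, N A = 0 → A = 0
  invariant : ∀ U ∈ Matrix.unitaryGroup (Fin n) ℂ, ∀ V ∈ Matrix.unitaryGroup (Fin n) ℂ,
    ∀ A, N (U * A * V) = N A

/-!
Write `h = g ∘ f`, `S = h(A) + h(B)` and `G = g⁻¹`.  Both inequalities, and the location of the spectrum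
of `S`, come from one superadditivity theorem (`weakMaj_cfc_add`): for a nonnegative convex function
`φ` with `φ 0 = 0`, the eigenvalues of `φ(A) + φ(B)` are weakly majorized by those of `φ(A + B)`.

It is applied twice.  With `φ = h⁺`, which agrees with `h` on the spectra of `A` and `B`, it gives
`S ≺_w h⁺(A + B)`; in particular the spectrum of `S` lies in `[g 0, h⁺ r]`, where `r` is the largest
eigenvalue of `A + B`, and this interval is covered by `g` (`GConvexOn.Icc_subset_image`).  With
`φ y = G (max y (g 0))`, convex as the inverse of an increasing concave function, and `h(A)`, `h(B)` in
place of `A`, `B`, it gives `f(A) + f(B) ≺_w G(S)`.  Such functions `φ` preserve weak majorization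
(`WeakMaj.comp_convexOn`), so the first application also gives `G(S) ≺_w f⁺(A + B)`, which is bounded by
`|f|(A + B)`.  Ky Fan dominance (`IsUnitarilyInvariantNorm.diagonalSeminorm_le`) turns these relations
into inequalities of norms.

On a finite set a convex function as above is a nonnegative combination of angle functions
`t ↦ (t - a)₊` (`exists_mem_angleCone_eqOn`), which reduces superadditivity to a single angle function
(`weakMaj_posPart`).  There it rests on a comparison of projections: if `A'` and `B'` are positive
semidefinite and supported on projections `E` and `F`, then a spectral projection `R` of `A' + B'` onto
its largest eigenvalues satisfies `tr (R E) + tr (R F) ≥ tr R` (`re_trace_top_le`).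
-/

/-! ### Traces and the top spectral projection -/

section MatrixInequalities

open scoped MatrixOrder
open Matrix

variable {n : ℕ}

lemma re_trace_mul_nonneg {P Q : Matrix (Fin n) (Fin n) ℂ} (hP : 0 ≤ P) (hQ : 0 ≤ Q) :
    0 ≤ (P * Q).trace.re := by
  obtain ⟨B, rfl⟩ := (CStarAlgebra.nonneg_iff_eq_star_mul_self (a := Q)).1 hQ
  have h : (0 : Matrix (Fin n) (Fin n) ℂ) ≤ B * P * star B := by
    simpa using star_left_conjugate_nonneg hP (star B)
  have h' := (Matrix.nonneg_iff_posSemidef.1 h).trace_nonneg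
  rw [← mul_assoc, Matrix.trace_mul_comm, ← mul_assoc]
  exact (Complex.le_def.1 h').1

lemma re_trace_mul_le_re_trace_mul {P Q Q' : Matrix (Fin n) (Fin n) ℂ} (hP : 0 ≤ P)
    (h : Q ≤ Q') : (P * Q).trace.re ≤ (P * Q').trace.re := by
  have := re_trace_mul_nonneg hP (sub_nonneg.2 h)
  rw [mul_sub, Matrix.trace_sub, Complex.sub_re] at this
  linarith

lemma conj_nonneg_of_isSelfAdjoint {P C : Matrix (Fin n) (Fin n) ℂ} (hP : 0 ≤ P)
    (hC : IsSelfAdjoint C) : 0 ≤ C * P * C := by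
  have := star_left_conjugate_nonneg hP C
  rwa [hC.star_eq] at this

/-- The algebraic core of the comparison of `E` with the top spectral projection `R` of a positive
semidefinite matrix `S ≥ A'`: in the application `G`, `H = G⁻¹` and `K` are functions of `S`, all
normalized so that the cutting level is `1`.  The matrix `X = E G E + (1 - E)` is invertible,
and its inverse `Y` dominates both `A'` and `1`.  Hence
`tr (K A') = tr (E K E A') ≤ tr (E K E Y) = tr E - tr (E (1 - R) E Y) ≤ tr E - tr (E (1 - R))`. -/
lemma re_trace_mul_le_of_le_inverse {A' E R K G H : Matrix (Fin n) (Fin n) ℂ} {ε : ℝ}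
    (hε : 0 < ε) (hε1 : ε ≤ 1)
    (hE : IsSelfAdjoint E) (hEE : E * E = E) (hAE : A' * E = A') (hA : 0 ≤ A') (hAH : A' ≤ H)
    (hGH : G * H = 1) (hG1 : G ≤ 1) (hεG : algebraMap ℝ _ ε ≤ G) (hR : R ≤ 1) (hK : 0 ≤ K)
    (hKGR : K = G - (1 - R)) :
    (K * A').trace.re ≤ (R * E).trace.re := by
  have hA0 : IsSelfAdjoint A' := .of_nonneg hA
  have hε0 : (0 : Matrix (Fin n) (Fin n) ℂ) ≤ algebraMap ℝ _ ε := by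
    rw [Algebra.algebraMap_eq_smul_one]; exact smul_nonneg hε.le zero_le_one
  have hG0 : 0 ≤ G := hε0.trans hεG
  have hG : IsSelfAdjoint G := .of_nonneg hG0
  have hEA : E * A' = A' := by
    have := congrArg star hAE
    rwa [star_mul, hE.star_eq, hA0.star_eq] at this
  have hE1 : 0 ≤ 1 - E := by
    have : IsSelfAdjoint (1 - E) := (IsSelfAdjoint.one _).sub hE
    have h := this.mul_self_nonneg
    rwa [show (1 - E) * (1 - E) = 1 - E by
      rw [sub_mul, mul_sub, mul_sub, hEE]; simp] at h
  set X : Matrix (Fin n) (Fin n) ℂ := E * G * E + (1 - E) with hX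
  have hXε : algebraMap ℝ _ ε ≤ X := by
    have h1 := conj_nonneg_of_isSelfAdjoint (sub_nonneg.2 hεG) hE
    have h2 : (0 : Matrix (Fin n) (Fin n) ℂ) ≤ (1 - ε) • (1 - E) :=
      smul_nonneg (by linarith) hE1
    rw [← sub_nonneg]
    convert add_nonneg h1 h2 using 1
    simp only [hX, Algebra.algebraMap_eq_smul_one, mul_sub, sub_mul, mul_smul_comm, smul_mul_assoc,
      mul_one, hEE, sub_smul, smul_sub, one_smul]
    abel
  have hX0 : 0 ≤ X := hε0.trans hXε
  have hXs : IsSelfAdjoint X := .of_nonneg hX0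
  have hXu : IsUnit X := by
    refine spectrum.isUnit_of_zero_notMem ℝ fun h => ?_
    have := (algebraMap_le_iff_le_spectrum (a := X) (r := ε)).1 hXε 0 h
    linarith
  obtain ⟨u, hu⟩ := hXu
  obtain ⟨Y, hXY, hYX⟩ : ∃ Y : Matrix (Fin n) (Fin n) ℂ, X * Y = 1 ∧ Y * X = 1 :=
    ⟨↑u⁻¹, by simp [← hu], by simp [← hu]⟩
  have hYs : IsSelfAdjoint Y := by
    have h := congrArg star hXY
    rw [star_mul, hXs.star_eq, star_one] at h
    exact left_inv_eq_right_inv h hXY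
  -- `Y - 1 = (Y - 1) X (Y - 1) + (1 - X)`, where `1 - X = E (1 - G) E`.
  have hY1 : 1 ≤ Y := by
    have h1 := conj_nonneg_of_isSelfAdjoint hX0 (hYs.sub (IsSelfAdjoint.one _))
    have h2 := conj_nonneg_of_isSelfAdjoint (sub_nonneg.2 hG1) hE
    rw [← sub_nonneg]
    convert add_nonneg h1 h2 using 1
    have e1 : (Y - 1) * X * (Y - 1) = Y - 1 - 1 + X := by
      simp only [sub_mul, mul_sub, hYX, mul_one, one_mul, hXY]; abel
    have e2 : E * (1 - G) * E = E - E * G * E := by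
      simp only [sub_mul, mul_sub, mul_one, hEE]
    rw [e1, e2, hX]; abel
  -- `Y - A' = (A' - Y) X (A' - Y) + (A' - A' G A')`, and `A' - A' G A'` is the sum of
  -- `(1 - A' G) A' (1 - G A')` and `A' G (H - A') G A'`.
  have hYA : A' ≤ Y := by
    have h1 := conj_nonneg_of_isSelfAdjoint hX0 (hA0.sub hYs)
    have h2 : 0 ≤ (1 - A' * G) * A' * (1 - G * A') := by
      have := star_left_conjugate_nonneg hA (1 - G * A')
      rwa [star_sub, star_mul, star_one, hG.star_eq, hA0.star_eq] at this
    have h3 : 0 ≤ A' * G * (H - A') * (G * A') := by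
      have := star_left_conjugate_nonneg (sub_nonneg.2 hAH) (G * A')
      rwa [star_mul, hG.star_eq, hA0.star_eq] at this
    rw [← sub_nonneg]
    convert add_nonneg h1 (add_nonneg h2 h3) using 1
    have e0 : A' * X * A' = A' * G * A' := by
      have : A' * (E * G * E) * A' = (A' * E) * G * (E * A') := by simp only [mul_assoc]
      rw [hX, mul_add, add_mul, this, hAE, hEA, mul_sub, mul_one, hAE]
      simp
    have e1 : (A' - Y) * X * (A' - Y) = A' * G * A' - A' - A' + Y := by
      have : A' * X * Y = A' := by rw [mul_assoc, hXY, mul_one]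
      simp only [sub_mul, mul_sub, hYX, one_mul, this, e0]; abel
    have e2 : A' * G * (H - A') * (G * A') = A' * G * A' - A' * G * A' * G * A' := by
      have : A' * G * H * (G * A') = A' * G * A' := by
        rw [mul_assoc A' G H, hGH, mul_one, mul_assoc]
      rw [mul_sub, sub_mul, this]; simp only [mul_assoc]
    have e3 : (1 - A' * G) * A' * (1 - G * A') =
        A' - A' * G * A' - A' * G * A' + A' * G * A' * G * A' := by
      noncomm_ring
    rw [e1, e2, e3]; abel
  set M := E * K * E with hM
  have hM0 : 0 ≤ M := conj_nonneg_of_isSelfAdjoint hK hE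
  have t1 : (K * A').trace = (M * A').trace := by
    rw [hM, mul_assoc, hEA, mul_assoc, Matrix.trace_mul_comm E, mul_assoc, hAE]
  have t2 := re_trace_mul_le_re_trace_mul hM0 hYA
  have hR0 : 0 ≤ E * (1 - R) * E := conj_nonneg_of_isSelfAdjoint (sub_nonneg.2 hR) hE
  have t3 := re_trace_mul_le_re_trace_mul hR0 hY1
  have hEY : (1 - E) * Y = 1 - E := by
    have : (1 - E) * X = 1 - E := by
      rw [hX, mul_add, ← mul_assoc, ← mul_assoc, sub_mul 1 E E, hEE]
      simp only [one_mul, sub_self, zero_mul, zero_add, sub_mul, mul_sub, mul_one, hEE]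
      abel
    calc (1 - E) * Y = (1 - E) * X * Y := by rw [this]
      _ = 1 - E := by rw [mul_assoc, hXY, mul_one]
  have t4 : M * Y = E - E * (1 - R) * E * Y := by
    have : M = X - (1 - E) - E * (1 - R) * E := by
      rw [hM, hKGR, hX]; noncomm_ring
    rw [this, sub_mul, sub_mul, hXY, hEY]; abel
  have t5 : (E * (1 - R) * E).trace = E.trace - (R * E).trace := by
    rw [mul_assoc, Matrix.trace_mul_comm, mul_assoc, hEE, sub_mul, one_mul, Matrix.trace_sub]
  rw [t4, Matrix.trace_sub, Complex.sub_re] at t2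
  rw [mul_one, t5, Complex.sub_re] at t3
  rw [t1]; linarith

end MatrixInequalities

/-! ### Weak majorization and angle functions -/

/-- Weak majorization `x ≺_w y` of finite real families, in the form that needs no sorting: the
sums of the positive parts of `x - s` are dominated by those of `y - s` for all levels `s ≥ 0`.  For
nonnegative families this is equivalent to domination of all sums of the `k` largest entries. -/
def WeakMaj {ι : Type*} [Fintype ι] (x y : ι → ℝ) : Prop :=
  ∀ s : ℝ, 0 ≤ s → ∑ i, max (x i - s) 0 ≤ ∑ i, max (y i - s) 0

lemma weakMaj_of_forall_pos {ι : Type*} [Fintype ι] {x y : ι → ℝ}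
    (h : ∀ s : ℝ, 0 < s → ∑ i, max (x i - s) 0 ≤ ∑ i, max (y i - s) 0) : WeakMaj x y := by
  have hc : ∀ z : ι → ℝ, Continuous fun s : ℝ => ∑ i, max (z i - s) 0 := fun z => by fun_prop
  intro s hs
  have hcl : IsClosed {s : ℝ | ∑ i, max (x i - s) 0 ≤ ∑ i, max (y i - s) 0} :=
    isClosed_le (hc x) (hc y)
  have : closure (Set.Ioi (0 : ℝ)) ⊆ {s : ℝ | ∑ i, max (x i - s) 0 ≤ ∑ i, max (y i - s) 0} :=
    closure_minimal h hcl
  rw [closure_Ioi] at this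
  exact this hs

section MatrixInequalities

open scoped MatrixOrder
open Matrix

variable {n : ℕ}

lemma continuousOn_spectrum_matrix (A : Matrix (Fin n) (Fin n) ℂ) (φ : ℝ → ℝ) :
    ContinuousOn φ (spectrum ℝ A) :=
  A.finite_real_spectrum.continuousOn φ

lemma re_trace_cfc {A : Matrix (Fin n) (Fin n) ℂ} (hA : A.IsHermitian) (φ : ℝ → ℝ) :
    (cfc φ A).trace.re = ∑ i, φ (hA.eigenvalues i) := by
  rw [hA.cfc_eq, IsHermitian.cfc, Unitary.conjStarAlgAut_apply, trace_mul_cycle,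
    Unitary.coe_star_mul_self, one_mul, trace_diagonal]
  simp

lemma forall_mem_spectrum_iff {A : Matrix (Fin n) (Fin n) ℂ} (hA : A.IsHermitian) {p : ℝ → Prop} :
    (∀ x ∈ spectrum ℝ A, p x) ↔ ∀ i, p (hA.eigenvalues i) := by
  rw [hA.spectrum_real_eq_range_eigenvalues, Set.forall_mem_range]

lemma isHermitian_cfc (A : Matrix (Fin n) (Fin n) ℂ) (φ : ℝ → ℝ) : (cfc φ A).IsHermitian :=
  cfc_predicate φ A

lemma cfc_sub_algebraMap {X : Matrix (Fin n) (Fin n) ℂ} (hX : X.IsHermitian) (s : ℝ) :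
    cfc (fun x => x - s) X = X - algebraMap ℝ _ s := by
  have hX' : IsSelfAdjoint X := hX
  rw [cfc_sub _ _ _ (continuousOn_spectrum_matrix _ _) (continuousOn_spectrum_matrix _ _),
    cfc_id' ℝ X, cfc_const s X]

/-- The trace of `R (X - s)` over `0 ≤ R ≤ 1` is at most the trace of `(X - s)₊`. -/
lemma re_trace_mul_sub_le {X R : Matrix (Fin n) (Fin n) ℂ} (hX : X.IsHermitian) (hR : 0 ≤ R)
    (hR1 : R ≤ 1) (s : ℝ) :
    (R * X).trace.re - s * R.trace.re ≤ ∑ i, max (hX.eigenvalues i - s) 0 := by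
  have hX' : IsSelfAdjoint X := hX
  have h1 : X - algebraMap ℝ _ s ≤ cfc (fun x => max (x - s) 0) X := by
    rw [← cfc_sub_algebraMap hX]
    exact cfc_mono (fun x _ => le_max_left _ _) (continuousOn_spectrum_matrix _ _)
      (continuousOn_spectrum_matrix _ _)
  have h2 : 0 ≤ cfc (fun x => max (x - s) 0) X := cfc_nonneg fun x _ => le_max_right _ _
  have h3 := re_trace_mul_le_re_trace_mul hR h1
  have h4 := re_trace_mul_le_re_trace_mul h2 hR1
  rw [mul_one, re_trace_cfc hX] at h4
  rw [mul_sub, Algebra.algebraMap_eq_smul_one, mul_smul_comm, mul_one, trace_sub, trace_smul,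
    Complex.sub_re, Complex.smul_re, smul_eq_mul] at h3
  rw [trace_mul_comm R (cfc _ X)] at h3
  linarith

/-- Equality holds in `re_trace_mul_sub_le` for the spectral projection of `X` above `s`. -/
lemma sum_posPart_sub_eq {X : Matrix (Fin n) (Fin n) ℂ} (hX : X.IsHermitian) (s : ℝ) :
    ∑ i, max (hX.eigenvalues i - s) 0 =
      (cfc (fun x : ℝ => if s < x then (1 : ℝ) else 0) X * X).trace.re -
        s * (cfc (fun x : ℝ => if s < x then (1 : ℝ) else 0) X).trace.re := by
  have hX' : IsSelfAdjoint X := hX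
  rw [← re_trace_cfc hX fun x => max (x - s) 0]
  have : cfc (fun x => max (x - s) 0) X =
      cfc (fun x : ℝ => if s < x then (1 : ℝ) else 0) X * X -
        s • cfc (fun x : ℝ => if s < x then (1 : ℝ) else 0) X := by
    nth_rewrite 3 [← cfc_id' ℝ X]
    rw [← cfc_mul _ _ _ (continuousOn_spectrum_matrix _ _) (continuousOn_spectrum_matrix _ _),
      ← cfc_smul _ _ _ (continuousOn_spectrum_matrix _ _),
      ← cfc_sub _ _ _ (continuousOn_spectrum_matrix _ _) (continuousOn_spectrum_matrix _ _)]
    refine cfc_congr fun x _ => ?_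
    split_ifs with h
    · rw [max_eq_left (by linarith)]; simp
    · rw [max_eq_right (by linarith)]; simp
  rw [this, trace_sub, trace_smul, Complex.sub_re, Complex.smul_re, smul_eq_mul]

/-- For `0 ≤ A' ≤ X` supported on the range of a projection `E`, the projection `R` of `X` to the
eigenvalues above `s` satisfies `tr (X⁻¹ R A') ≤ tr (R E)`.  Summed over `X = A' + B'`, the left-hand
sides add up to `tr R`. -/
lemma re_trace_top_le {X A' E : Matrix (Fin n) (Fin n) ℂ} (hX : X.IsHermitian) {s : ℝ} (hs : 0 < s)
    (hE : IsSelfAdjoint E) (hEE : E * E = E) (hAE : A' * E = A') (hA : 0 ≤ A') (hAX : A' ≤ X) :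
    s⁻¹ * (cfc (fun x : ℝ => if s < x then s / x else 0) X * A').trace.re ≤
      (cfc (fun x : ℝ => if s < x then 1 else 0) X * E).trace.re := by
  have hX' : IsSelfAdjoint X := hX
  obtain ⟨b, hb⟩ := X.finite_real_spectrum.bddAbove
  have hbs : 0 < max b s := lt_max_of_lt_right hs
  have hA' : s⁻¹ • A' ≤ s⁻¹ • X := smul_le_smul_of_nonneg_left hAX (by positivity)
  have hXH : s⁻¹ • X ≤ cfc (fun x : ℝ => if s < x then x / s else 1) X := by
    conv_lhs => rw [← cfc_id' ℝ X]
    rw [← cfc_smul _ _ _ (continuousOn_spectrum_matrix _ _)]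
    refine cfc_mono (fun x _ => ?_) (continuousOn_spectrum_matrix _ _)
      (continuousOn_spectrum_matrix _ _)
    split_ifs with h
    · simp [div_eq_inv_mul]
    · rw [smul_eq_mul, inv_mul_le_iff₀ hs]; linarith
  have key := re_trace_mul_le_of_le_inverse (A' := s⁻¹ • A') (E := E)
    (R := cfc (fun x : ℝ => if s < x then 1 else 0) X)
    (K := cfc (fun x : ℝ => if s < x then s / x else 0) X)
    (G := cfc (fun x : ℝ => if s < x then s / x else 1) X)
    (H := cfc (fun x : ℝ => if s < x then x / s else 1) X)
    (ε := s / max b s) (by positivity) ((div_le_one hbs).2 (le_max_right _ _)) hE hEE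
    (by rw [smul_mul_assoc, hAE]) (smul_nonneg (by positivity) hA) (hA'.trans hXH) ?_ ?_ ?_ ?_ ?_ ?_
  · rwa [mul_smul_comm, trace_smul, Complex.smul_re, smul_eq_mul] at key
  · rw [← cfc_mul _ _ _ (continuousOn_spectrum_matrix _ _) (continuousOn_spectrum_matrix _ _),
      ← cfc_one ℝ X]
    refine cfc_congr fun x _ => ?_
    simp only [Pi.one_apply]
    split_ifs with h
    · have : 0 < x := hs.trans h
      field_simp
    · simp
  · refine cfc_le_one _ _ fun x _ => ?_
    split_ifs with h
    · exact (div_le_one (hs.trans h)).2 h.le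
    · exact le_rfl
  · refine algebraMap_le_cfc _ _ _ (fun x hx => ?_) (continuousOn_spectrum_matrix _ _)
    split_ifs with h
    · exact div_le_div_of_nonneg_left hs.le (hs.trans h) ((hb hx).trans (le_max_left _ _))
    · exact (div_le_one hbs).2 (le_max_right _ _)
  · refine cfc_le_one _ _ fun x _ => ?_
    split_ifs <;> simp
  · refine cfc_nonneg fun x _ => ?_
    split_ifs with h
    · have : 0 < x := hs.trans h
      positivity
    · exact le_rfl
  · rw [← cfc_one ℝ X,
      ← cfc_sub _ _ _ (continuousOn_spectrum_matrix _ _) (continuousOn_spectrum_matrix _ _),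
      ← cfc_sub _ _ _ (continuousOn_spectrum_matrix _ _) (continuousOn_spectrum_matrix _ _)]
    refine cfc_congr fun x _ => ?_
    simp only [Pi.one_apply]
    split_ifs <;> simp

/-- Superadditivity in the sense of weak majorization for the angle function `t ↦ (t - a)₊`.
With `A' = (A - a)₊`, `B' = (B - a)₊`, `E` and `F` the spectral projections of `A` and `B` above `a`,
and `R` that of `A' + B'` above `s`, the point is that `tr (R E) + tr (R F) ≥ tr R`.  Since
`A' + a E ≤ A` and `B' + a F ≤ B`, the trace of `R (A' + B' - s)` is then at most that of
`R (A + B - a - s)`. -/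
lemma weakMaj_posPart {A B : Matrix (Fin n) (Fin n) ℂ} (hA : A.PosSemidef) (hB : B.PosSemidef)
    {a : ℝ} (ha : 0 ≤ a)
    (hX : (cfc (fun x => max (x - a) 0) A + cfc (fun x => max (x - a) 0) B).IsHermitian)
    (hC : (A + B).IsHermitian) :
    WeakMaj hX.eigenvalues (fun i => max (hC.eigenvalues i - a) 0) := by
  refine weakMaj_of_forall_pos fun s hs => ?_
  have cut : ∀ {D : Matrix (Fin n) (Fin n) ℂ}, D.PosSemidef →
      0 ≤ cfc (fun x => max (x - a) 0) D ∧
      IsSelfAdjoint (cfc (fun x : ℝ => if a < x then (1 : ℝ) else 0) D) ∧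
      cfc (fun x : ℝ => if a < x then (1 : ℝ) else 0) D *
        cfc (fun x : ℝ => if a < x then (1 : ℝ) else 0) D =
        cfc (fun x : ℝ => if a < x then (1 : ℝ) else 0) D ∧
      cfc (fun x => max (x - a) 0) D * cfc (fun x : ℝ => if a < x then (1 : ℝ) else 0) D =
        cfc (fun x => max (x - a) 0) D ∧
      cfc (fun x => max (x - a) 0) D + a • cfc (fun x : ℝ => if a < x then (1 : ℝ) else 0) D ≤ D
      := by
    intro D hD
    have hD' : IsSelfAdjoint D := hD.1
    refine ⟨cfc_nonneg fun x _ => le_max_right _ _, cfc_predicate _ _, ?_, ?_, ?_⟩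
    · rw [← cfc_mul _ _ _ (continuousOn_spectrum_matrix _ _) (continuousOn_spectrum_matrix _ _)]
      refine cfc_congr fun x _ => ?_
      simp
    · rw [← cfc_mul _ _ _ (continuousOn_spectrum_matrix _ _) (continuousOn_spectrum_matrix _ _)]
      refine cfc_congr fun x _ => ?_
      split_ifs with h
      · rw [mul_one]
      · rw [mul_zero, max_eq_right (by linarith)]
    · conv_rhs => rw [← cfc_id' ℝ D]
      rw [← cfc_smul _ _ _ (continuousOn_spectrum_matrix _ _),
        ← cfc_add _ _ _ (continuousOn_spectrum_matrix _ _) (continuousOn_spectrum_matrix _ _)]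
      refine cfc_mono (fun x hx => ?_) (continuousOn_spectrum_matrix _ _)
        (continuousOn_spectrum_matrix _ _)
      have hx0 : 0 ≤ x := spectrum_nonneg_of_nonneg hD.nonneg hx
      split_ifs with h
      · rw [max_eq_left (by linarith)]; simp
      · rw [max_eq_right (by linarith)]; simpa using hx0
  obtain ⟨hA0, hEs, hEE, hAE, hAa⟩ := cut hA
  obtain ⟨hB0, hFs, hFF, hBF, hBa⟩ := cut hB
  set A' := cfc (fun x => max (x - a) 0) A
  set B' := cfc (fun x => max (x - a) 0) B
  set E := cfc (fun x : ℝ => if a < x then (1 : ℝ) else 0) A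
  set F := cfc (fun x : ℝ => if a < x then (1 : ℝ) else 0) B
  have hX' : IsSelfAdjoint (A' + B') := hX
  set R := cfc (fun x : ℝ => if s < x then (1 : ℝ) else 0) (A' + B') with hRdef
  have hR0 : 0 ≤ R := cfc_nonneg fun x _ => by split_ifs <;> simp
  have hR1 : R ≤ 1 := cfc_le_one _ _ fun x _ => by split_ifs <;> simp
  have hEF : R.trace.re ≤ (R * E).trace.re + (R * F).trace.re := by
    have h1 := re_trace_top_le hX hs hEs hEE hAE hA0 (le_add_of_nonneg_right hB0)
    have h2 := re_trace_top_le hX hs hFs hFF hBF hB0 (le_add_of_nonneg_left hA0)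
    refine le_trans (le_of_eq ?_) (add_le_add h1 h2)
    rw [← mul_add, ← Complex.add_re, ← trace_add, ← mul_add]
    have : cfc (fun x : ℝ => if s < x then s / x else 0) (A' + B') * (A' + B') = s • R := by
      nth_rewrite 2 [← cfc_id' ℝ (A' + B')]
      rw [← cfc_mul _ _ _ (continuousOn_spectrum_matrix _ _) (continuousOn_spectrum_matrix _ _),
        hRdef, ← cfc_smul _ _ _ (continuousOn_spectrum_matrix _ _)]
      refine cfc_congr fun x _ => ?_
      split_ifs with h
      · have : 0 < x := hs.trans h
        simp [this.ne']
      · simp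
    rw [this, trace_smul, Complex.smul_re, smul_eq_mul, inv_mul_cancel_left₀ hs.ne']
  have hsum := sum_posPart_sub_eq hX s
  have hAB := re_trace_mul_le_re_trace_mul hR0 (add_le_add hAa hBa)
  have hC1 := re_trace_mul_sub_le hC hR0 hR1 (a + s)
  have hm : ∀ i, max (max (hC.eigenvalues i - a) 0 - s) 0 = max (hC.eigenvalues i - (a + s)) 0 := by
    intro i
    rcases le_total (hC.eigenvalues i - a) 0 with h | h
    · rw [max_eq_right h, max_eq_right (by linarith), max_eq_right (by linarith)]
    · rw [max_eq_left h]; congr 1; ring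
  simp only [hm]
  rw [hsum]
  simp only [mul_add, mul_smul_comm, trace_add, trace_smul, Complex.add_re, Complex.smul_re,
    smul_eq_mul] at hAB hC1 ⊢
  nlinarith [mul_le_mul_of_nonneg_left hEF ha]

end MatrixInequalities

/-! ### Convex functions -/

/-- The convex cone of functions `t ↦ ∑ cᵢ (t - aᵢ)₊` with `aᵢ, cᵢ ≥ 0`. -/
def angleCone : Submodule NNReal (ℝ → ℝ) :=
  Submodule.span NNReal (Set.range fun (a : NNReal) (t : ℝ) => max (t - a) 0)

/-- Piecewise linear interpolation: on a finite set a nonnegative convex function vanishing at `0`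
agrees with a member of `angleCone`. -/
lemma exists_mem_angleCone_eqOn {r : ℝ} {φ : ℝ → ℝ}
    (hφ : ConvexOn ℝ (Set.Icc 0 r) φ) (h0 : φ 0 = 0) (hnn : ∀ t ∈ Set.Icc 0 r, 0 ≤ φ t)
    (T : Finset ℝ) (hT : ∀ t ∈ T, t ∈ Set.Icc 0 r) :
    ∃ ψ ∈ angleCone, ∀ t ∈ T, ψ t = φ t := by
  -- To the right of the last node `p` the interpolant is affine and stays below `φ`.
  suffices h : ∃ ψ ∈ angleCone, (∀ t ∈ T, ψ t = φ t) ∧ ∃ p ∈ insert 0 T, (∀ t ∈ T, t ≤ p) ∧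
      ∃ σ : ℝ, (∀ t, p ≤ t → ψ t = φ p + σ * (t - p)) ∧
        ∀ t ∈ Set.Icc p r, φ p + σ * (t - p) ≤ φ t by
    obtain ⟨ψ, h1, h2, -⟩ := h
    exact ⟨ψ, h1, h2⟩
  induction T using Finset.induction_on_max with
  | empty =>
    refine ⟨0, zero_mem _, by simp, 0, by simp, by simp, 0, ?_, ?_⟩
    · intro t _; simp [h0]
    · intro t ht; simpa [h0] using hnn t ht
  | insert m T hm ih =>
    obtain ⟨ψ, hψ, heq, p, hpT, hp, σ, hr1, hr2⟩ := ih fun t ht => hT t (Finset.mem_insert_of_mem ht)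
    have hmI := hT m (Finset.mem_insert_self _ _)
    have hpm : 0 ≤ p ∧ p ≤ m := by
      rcases Finset.mem_insert.1 hpT with rfl | h
      · exact ⟨le_rfl, hmI.1⟩
      · exact ⟨(hT p (Finset.mem_insert_of_mem h)).1, (hm p h).le⟩
    rcases hpm.2.eq_or_lt with rfl | hlt
    · refine ⟨ψ, hψ, ?_, p, by simp, ?_, σ, hr1, hr2⟩
      · intro t ht
        rcases Finset.mem_insert.1 ht with rfl | h
        · simpa using hr1 t le_rfl
        · exact heq t h
      · intro t ht
        rcases Finset.mem_insert.1 ht with rfl | h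
        · exact le_rfl
        · exact hp t h
    · have hd : 0 < m - p := sub_pos.2 hlt
      obtain ⟨c, hc⟩ : ∃ c : ℝ, c = (φ m - φ p) / (m - p) - σ := ⟨_, rfl⟩
      have hc0 : 0 ≤ c := by
        rw [hc, sub_nonneg, le_div_iff₀ hd]
        linarith [hr2 m ⟨hlt.le, hmI.2⟩]
      have hcm : φ m = φ p + (σ + c) * (m - p) := by
        rw [hc]; field_simp; ring
      lift c to NNReal using hc0
      refine ⟨ψ + c • fun t => max (t - p) 0, add_mem hψ
        (Submodule.smul_mem _ _ (Submodule.subset_span ⟨⟨p, hpm.1⟩, rfl⟩)), ?_, m, by simp, ?_,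
        σ + c, ?_, ?_⟩
      · intro t ht
        simp only [Pi.add_apply, Pi.smul_apply, NNReal.smul_def, smul_eq_mul]
        rcases Finset.mem_insert.1 ht with rfl | h
        · rw [hr1 t hlt.le, max_eq_left hd.le, hcm]; ring
        · rw [heq t h, max_eq_right (by linarith [hp t h])]; simp
      · intro t ht
        rcases Finset.mem_insert.1 ht with rfl | h
        · exact le_rfl
        · exact (hm t h).le
      · intro t ht
        simp only [Pi.add_apply, Pi.smul_apply, NNReal.smul_def, smul_eq_mul]
        rw [hr1 t (hlt.le.trans ht), max_eq_left (by linarith), hcm]; ring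
      · intro t ht
        rcases ht.1.eq_or_lt with rfl | hmt
        · simp
        · have h := hφ.slope_mono_adjacent (x := p) (y := m) (z := t) ⟨hpm.1, hpm.2.trans hmI.2⟩
            ⟨hmI.1.trans ht.1, ht.2⟩ hlt hmt
          rw [show (φ m - φ p) / (m - p) = σ + c by rw [hc]; ring,
            le_div_iff₀ (sub_pos.2 hmt)] at h
          linarith

lemma WeakMaj.sum_le_of_mem_angleCone {ι : Type*} [Fintype ι] {x y : ι → ℝ} (h : WeakMaj x y)
    {ψ : ℝ → ℝ} (hψ : ψ ∈ angleCone) : ∑ i, ψ (x i) ≤ ∑ i, ψ (y i) := by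
  induction hψ using Submodule.span_induction with
  | mem ψ hψ =>
    obtain ⟨a, rfl⟩ := hψ
    exact h a a.2
  | zero => simp
  | add f g _ _ hf hg => simpa [Finset.sum_add_distrib] using add_le_add hf hg
  | smul c f _ hf =>
    simpa [NNReal.smul_def, ← Finset.mul_sum] using mul_le_mul_of_nonneg_left hf c.2

/-- Weak majorization is preserved by convex functions vanishing at `0`: the positive part of `φ - s`
is again of the kind that `angleCone` interpolates. -/
lemma WeakMaj.comp_convexOn {ι : Type*} [Fintype ι] {x y : ι → ℝ} (h : WeakMaj x y) {r : ℝ}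
    {φ : ℝ → ℝ} (hφ : ConvexOn ℝ (Set.Icc 0 r) φ) (h0 : φ 0 = 0)
    (hx : ∀ i, x i ∈ Set.Icc 0 r) (hy : ∀ i, y i ∈ Set.Icc 0 r) :
    WeakMaj (fun i => φ (x i)) (fun i => φ (y i)) := by
  classical
  intro s hs
  have hconv : ConvexOn ℝ (Set.Icc 0 r) fun t => max (φ t - s) 0 :=
    (hφ.sub (concaveOn_const s (convex_Icc _ _))).sup (convexOn_const 0 (convex_Icc _ _))
  obtain ⟨ψ, hψ, heq⟩ := exists_mem_angleCone_eqOn hconv (by simp [h0, hs])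
    (fun t _ => le_max_right _ _) (Finset.univ.image x ∪ Finset.univ.image y) (by
      intro t ht
      simp only [Finset.mem_union, Finset.mem_image, Finset.mem_univ, true_and] at ht
      rcases ht with ⟨i, rfl⟩ | ⟨i, rfl⟩
      exacts [hx i, hy i])
  have := h.sum_le_of_mem_angleCone hψ
  rwa [Finset.sum_congr rfl fun i _ => heq (x i) (by simp),
    Finset.sum_congr rfl fun i _ => heq (y i) (by simp)] at this

/-- The positions of the `k` largest entries, separated from the others by a level `τ`. -/
lemma exists_finset_card_eq_top {ι : Type*} [Fintype ι] (c : ι → ℝ) {k : ℕ}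
    (hk : k ≤ Fintype.card ι) :
    ∃ I : Finset ι, I.card = k ∧ ∃ τ, (∀ i ∈ I, τ ≤ c i) ∧ ∀ i ∉ I, c i ≤ τ := by
  classical
  induction k with
  | zero =>
    obtain ⟨τ, hτ⟩ := (Set.finite_range c).bddAbove
    exact ⟨∅, rfl, τ, by simp, fun i _ => hτ ⟨i, rfl⟩⟩
  | succ k ih =>
    obtain ⟨I, hI, τ, h1, h2⟩ := ih (by omega)
    have hne : Iᶜ.Nonempty := by
      rw [← Finset.card_pos, Finset.card_compl]; omega
    obtain ⟨j, hj, hmax⟩ := Finset.exists_max_image Iᶜ c hne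
    rw [Finset.mem_compl] at hj
    refine ⟨insert j I, by rw [Finset.card_insert_of_notMem hj, hI], c j, ?_, ?_⟩
    · intro i hi
      rcases Finset.mem_insert.1 hi with rfl | hi
      · exact le_rfl
      · exact (h2 j hj).trans (h1 i hi)
    · intro i hi
      exact hmax i (by simp only [Finset.mem_insert, not_or] at hi; simpa using hi.2)

section MatrixInequalities

open scoped MatrixOrder
open Matrix

variable {n : ℕ}

lemma spectrum_le_of_add {A B : Matrix (Fin n) (Fin n) ℂ} (hA : A.PosSemidef) (hB : B.PosSemidef)
    {r : ℝ} (h : ∀ x ∈ spectrum ℝ (A + B), x ≤ r) : ∀ x ∈ spectrum ℝ A, x ∈ Set.Icc 0 r := by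
  intro x hx
  refine ⟨spectrum_nonneg_of_nonneg hA.nonneg hx, ?_⟩
  have hA' : IsSelfAdjoint A := hA.1
  have hC : IsSelfAdjoint (A + B) := hA.1.add hB.1
  have h1 : A ≤ algebraMap ℝ _ r :=
    (le_add_of_nonneg_right hB.nonneg).trans (le_algebraMap_of_spectrum_le h)
  exact (le_algebraMap_iff_spectrum_le).1 h1 x hx

/-- Superadditivity of convex functions on positive semidefinite matrices, in the sense of weak
majorization of the eigenvalues.  The summation over angle functions works because, for all of them at
once, the `k` largest values on the spectrum of `A + B` sit at the same positions. -/
theorem weakMaj_cfc_add {A B : Matrix (Fin n) (Fin n) ℂ} (hA : A.PosSemidef) (hB : B.PosSemidef)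
    {r : ℝ} {φ : ℝ → ℝ} (hφ : ConvexOn ℝ (Set.Icc 0 r) φ) (h0 : φ 0 = 0)
    (hnn : ∀ t ∈ Set.Icc 0 r, 0 ≤ φ t) (hspec : ∀ x ∈ spectrum ℝ (A + B), x ≤ r)
    (hX : (cfc φ A + cfc φ B).IsHermitian) (hC : (A + B).IsHermitian) :
    WeakMaj hX.eigenvalues (fun i => φ (hC.eigenvalues i)) := by
  classical
  have hsA := spectrum_le_of_add hA hB hspec
  have hsB := spectrum_le_of_add hB hA (by rwa [add_comm])
  have hsC : ∀ x ∈ spectrum ℝ (A + B), x ∈ Set.Icc 0 r := fun x hx =>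
    ⟨spectrum_nonneg_of_nonneg (hA.add hB).nonneg hx, hspec x hx⟩
  obtain ⟨ψ, hψ, heq⟩ := exists_mem_angleCone_eqOn hφ h0 hnn
    (A.finite_real_spectrum.toFinset ∪ B.finite_real_spectrum.toFinset ∪
      (A + B).finite_real_spectrum.toFinset) (by
      intro t ht
      simp only [Finset.mem_union, Set.Finite.mem_toFinset] at ht
      rcases ht with (ht | ht) | ht
      exacts [hsA t ht, hsB t ht, hsC t ht])
  simp only [Finset.mem_union, Set.Finite.mem_toFinset] at heq
  intro s hs
  rw [sum_posPart_sub_eq hX s]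
  have hX' : IsSelfAdjoint (cfc φ A + cfc φ B) := hX
  set R := cfc (fun x : ℝ => if s < x then (1 : ℝ) else 0) (cfc φ A + cfc φ B) with hRdef
  have hR0 : 0 ≤ R := cfc_nonneg fun x _ => by split_ifs <;> simp
  have hR1 : R ≤ 1 := cfc_le_one _ _ fun x _ => by split_ifs <;> simp
  obtain ⟨I, hI, τ, hτ1, hτ2⟩ := exists_finset_card_eq_top hC.eigenvalues
    (k := (Finset.univ.filter fun i => s < hX.eigenvalues i).card) (Finset.card_le_univ _)
  have hRtr : R.trace.re = I.card := by
    rw [hRdef, re_trace_cfc hX, hI, Finset.sum_boole]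
  -- Both sides are additive in `ψ`, so that angle functions suffice.
  have main : ∀ ψ ∈ angleCone,
      (R * (cfc ψ A + cfc ψ B)).trace.re ≤ ∑ i ∈ I, ψ (hC.eigenvalues i) := by
    intro ψ hψ
    induction hψ using Submodule.span_induction with
    | mem ψ hψ =>
      obtain ⟨a, rfl⟩ := hψ
      have hY : (cfc (fun t : ℝ => max (t - a) 0) A +
        cfc (fun t : ℝ => max (t - a) 0) B).IsHermitian :=
        (isHermitian_cfc _ _).add (isHermitian_cfc _ _)
      have h1 := re_trace_mul_sub_le hY hR0 hR1 (max (τ - a) 0)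
      have h2 := weakMaj_posPart hA hB a.2 hY hC _ (le_max_right (τ - a) 0)
      have h3 : ∑ i, max (max (hC.eigenvalues i - a) 0 - max (τ - a) 0) 0 =
          ∑ i ∈ I, (max (hC.eigenvalues i - a) 0 - max (τ - a) 0) := by
        rw [← Finset.sum_subset (Finset.subset_univ I)]
        · refine Finset.sum_congr rfl fun i hi => max_eq_left (sub_nonneg.2 ?_)
          exact max_le_max (sub_le_sub_right (hτ1 i hi) _) le_rfl
        · intro i _ hi
          refine max_eq_right (sub_nonpos.2 ?_)
          exact max_le_max (sub_le_sub_right (hτ2 i hi) _) le_rfl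
      have h4 := h1.trans (h2.trans_eq h3)
      rw [Finset.sum_sub_distrib, Finset.sum_const, nsmul_eq_mul, hRtr] at h4
      linarith
    | zero => simp [show (0 : ℝ → ℝ) = fun _ => 0 from rfl]
    | add f g _ _ hf hg =>
      have e : ∀ D : Matrix (Fin n) (Fin n) ℂ, cfc (f + g) D = cfc f D + cfc g D := fun D =>
        cfc_add _ _ _ (continuousOn_spectrum_matrix _ _) (continuousOn_spectrum_matrix _ _)
      rw [e, e, add_add_add_comm, mul_add, trace_add, Complex.add_re]
      simpa [Finset.sum_add_distrib] using add_le_add hf hg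
    | smul c f _ hf =>
      have e : ∀ D : Matrix (Fin n) (Fin n) ℂ, cfc (c • f) D = (c : ℝ) • cfc f D := fun D =>
        cfc_smul (c : ℝ) _ _ (continuousOn_spectrum_matrix _ _)
      rw [e, e, ← smul_add, mul_smul_comm, trace_smul, Complex.smul_re]
      simpa [NNReal.smul_def, ← Finset.mul_sum] using mul_le_mul_of_nonneg_left hf c.2
  have h1 := main ψ hψ
  rw [cfc_congr (g := φ) fun x hx => heq x (Or.inl (Or.inl hx)),
    cfc_congr (a := B) (g := φ) fun x hx => heq x (Or.inl (Or.inr hx)),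
    Finset.sum_congr rfl fun i _ =>
      heq (hC.eigenvalues i) (Or.inr (hC.eigenvalues_mem_spectrum_real i))] at h1
  calc _ ≤ ∑ i ∈ I, φ (hC.eigenvalues i) - s * I.card := by rw [hRtr]; linarith
    _ = ∑ i ∈ I, (φ (hC.eigenvalues i) - s) := by
      rw [Finset.sum_sub_distrib, Finset.sum_const, nsmul_eq_mul, mul_comm]
    _ ≤ ∑ i ∈ I, max (φ (hC.eigenvalues i) - s) 0 :=
      Finset.sum_le_sum fun i _ => le_max_left _ _
    _ ≤ ∑ i, max (φ (hC.eigenvalues i) - s) 0 :=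
      Finset.sum_le_sum_of_subset_of_nonneg (Finset.subset_univ I) fun i _ _ => le_max_right _ _

end MatrixInequalities

/-! ### Unitarily invariant norms and weak majorization -/

/-- Summation by parts without sorting: `d` is a nonnegative combination of the indicators of its
superlevel sets. -/
lemma sum_mul_nonneg_of_forall_superlevel {ι : Type*} [Fintype ι] {d w : ι → ℝ}
    (hd : ∀ i, 0 ≤ d i)
    (h : ∀ τ, 0 ≤ τ → 0 ≤ ∑ i with τ < d i, w i) : 0 ≤ ∑ i, d i * w i := by
  classical
  -- Peel off the smallest positive value `m` of `d` on its support.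
  induction hk : (Finset.univ.filter fun i => 0 < d i).card using Nat.strong_induction_on
    generalizing d with
  | _ k ih =>
    rcases (Finset.univ.filter fun i => 0 < d i).eq_empty_or_nonempty with he | hne
    · have : ∀ i, d i = 0 := fun i => le_antisymm (by
        have := Finset.filter_eq_empty_iff.1 he (Finset.mem_univ i)
        exact not_lt.1 this) (hd i)
      simp [this]
    · obtain ⟨j, hj, hmin⟩ := Finset.exists_min_image _ d hne
      simp only [Finset.mem_filter, Finset.mem_univ, true_and] at hj hmin
      set d' : ι → ℝ := fun i => if 0 < d i then d i - d j else 0 with hd'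
      have hd'0 : ∀ i, 0 ≤ d' i := by
        intro i
        simp only [hd']
        split_ifs with hi
        · exact sub_nonneg.2 (hmin i hi)
        · exact le_rfl
      have hlev : ∀ τ, 0 ≤ τ → ∀ i, τ < d' i ↔ τ + d j < d i := by
        intro τ hτ i
        simp only [hd']
        split_ifs with hi
        · exact lt_sub_iff_add_lt
        · constructor <;> intro _ <;> linarith
      have hlt : (Finset.univ.filter fun i => 0 < d' i).card < k := by
        rw [← hk]
        refine Finset.card_lt_card ⟨?_, ?_⟩
        · intro i hi
          simp only [Finset.mem_filter, Finset.mem_univ, true_and, hlev 0 le_rfl] at hi ⊢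
          linarith
        · intro hsub
          have := hsub (Finset.mem_filter.2 ⟨Finset.mem_univ j, hj⟩)
          simp only [Finset.mem_filter, Finset.mem_univ, true_and, hlev 0 le_rfl] at this
          linarith
      have h1 := ih _ hlt hd'0 (fun τ hτ => by
        simpa only [hlev τ hτ] using h (τ + d j) (by linarith)) rfl
      have h2 := mul_nonneg hj.le (h 0 le_rfl)
      rw [Finset.mul_sum, Finset.sum_filter] at h2
      have h3 : ∑ i, d i * w i = ∑ i, d' i * w i + ∑ i, if 0 < d i then d j * w i else 0 := by
        rw [← Finset.sum_add_distrib]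
        refine Finset.sum_congr rfl fun i _ => ?_
        simp only [hd']
        split_ifs with hi
        · ring
        · rw [le_antisymm (not_lt.1 hi) (hd i)]; ring
      linarith

lemma WeakMaj.sum_mul_le {ι : Type*} [Fintype ι] {d x z : ι → ℝ} (h : WeakMaj x z)
    (hd : ∀ i, 0 ≤ d i) (hz : ∀ i, 0 ≤ z i) (hdz : ∀ i j, d j < d i → z j ≤ z i) :
    ∑ i, d i * x i ≤ ∑ i, d i * z i := by
  classical
  suffices 0 ≤ ∑ i, d i * (z i - x i) by
    simp only [mul_sub, Finset.sum_sub_distrib] at this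
    linarith
  refine sum_mul_nonneg_of_forall_superlevel hd fun τ hτ => ?_
  set I := Finset.univ.filter fun i => τ < d i with hI
  obtain ⟨s, hs0, hsI, hsc⟩ : ∃ s, 0 ≤ s ∧ (∀ i ∈ I, s ≤ z i) ∧ ∀ i ∉ I, z i ≤ s := by
    rcases Iᶜ.eq_empty_or_nonempty with he | hne
    · refine ⟨0, le_rfl, fun i _ => hz i, fun i hi => ?_⟩
      rw [← Finset.mem_compl, he] at hi
      simp at hi
    · obtain ⟨j, hj, hmax⟩ := Finset.exists_max_image Iᶜ z hne
      refine ⟨z j, hz j, fun i hi => hdz i j ?_, fun i hi => hmax i (Finset.mem_compl.2 hi)⟩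
      simp only [hI, Finset.mem_compl, Finset.mem_filter, Finset.mem_univ, true_and] at hi hj
      linarith
  have h1 : ∑ i ∈ I, (x i - s) ≤ ∑ i, max (x i - s) 0 :=
    (Finset.sum_le_sum fun i _ => le_max_left _ _).trans
      (Finset.sum_le_sum_of_subset_of_nonneg (Finset.subset_univ I) fun i _ _ => le_max_right _ _)
  have h2 : ∑ i, max (z i - s) 0 = ∑ i ∈ I, (z i - s) := by
    rw [← Finset.sum_subset (Finset.subset_univ I)]
    · exact Finset.sum_congr rfl fun i hi => max_eq_left (sub_nonneg.2 (hsI i hi))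
    · exact fun i _ hi => max_eq_right (sub_nonpos.2 (hsc i hi))
  have h3 := (h1.trans (h s hs0)).trans_eq h2
  rw [Finset.sum_sub_distrib, Finset.sum_sub_distrib] at h3
  rw [Finset.sum_sub_distrib]
  linarith

lemma exists_perm_monovary {n : ℕ} (d y : Fin n → ℝ) :
    ∃ σ : Equiv.Perm (Fin n), ∀ i j, d j < d i → y (σ j) ≤ y (σ i) := by
  refine ⟨(Tuple.sort d).symm.trans (Tuple.sort y), fun i j hij => ?_⟩
  refine Tuple.monotone_sort y (le_of_not_gt fun hlt => ?_)
  have := Tuple.monotone_sort d hlt.le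
  simp only [Function.comp_apply, Equiv.apply_symm_apply] at this
  linarith

/-- A seminorm is attained at each point by a linear functional below it (Hahn–Banach). -/
lemma Seminorm.exists_dual {E : Type*} [AddCommGroup E] [Module ℝ E] (p : Seminorm ℝ E) (x : E) :
    ∃ ℓ : E →ₗ[ℝ] ℝ, ℓ x = p x ∧ ∀ y, ℓ y ≤ p y := by
  by_cases hx : p x = 0
  · exact ⟨0, by simp [hx], fun y => by simp⟩
  have hx0 : x ≠ 0 := fun h => hx (by simp [h])
  obtain ⟨ℓ, h1, h2⟩ := exists_extension_of_le_sublinear (LinearPMap.mkSpanSingleton x (p x) hx0) p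
    (fun c hc y => by rw [map_smul_eq_mul, Real.norm_of_nonneg hc.le]) (map_add_le_add p) (by
      rintro ⟨y, hy⟩
      obtain ⟨c, rfl⟩ := Submodule.mem_span_singleton.1 hy
      rw [LinearPMap.mkSpanSingleton'_apply, map_smul_eq_mul, smul_eq_mul]
      exact mul_le_mul_of_nonneg_right (le_abs_self c) (apply_nonneg p x))
  refine ⟨ℓ, ?_, h2⟩
  exact (h1 ⟨x, Submodule.mem_span_singleton_self x⟩).trans
    (LinearPMap.mkSpanSingleton_apply ℝ ℝ hx0 (p x))

/-- Monotonicity of symmetric gauge functions: the functional that norms `x` is compared with `p` at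
the signed rearrangement of `y` ordered like its coefficients. -/
lemma WeakMaj.seminorm_le {n : ℕ} (p : Seminorm ℝ (Fin n → ℝ))
    (hsign : ∀ ε y : Fin n → ℝ, (∀ i, |ε i| = 1) → p (fun i => ε i * y i) = p y)
    (hperm : ∀ (σ : Equiv.Perm (Fin n)) (y : Fin n → ℝ), p (fun i => y (σ i)) = p y)
    {x y : Fin n → ℝ} (hx : ∀ i, 0 ≤ x i) (h : WeakMaj x fun i => |y i|) : p x ≤ p y := by
  obtain ⟨ℓ, hℓx, hℓ⟩ := p.exists_dual x
  set c : Fin n → ℝ := fun i => ℓ (Pi.single i 1) with hc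
  have hℓc : ∀ z, ℓ z = ∑ i, c i * z i := by
    intro z
    conv_lhs => rw [pi_eq_sum_univ' z]
    simp only [map_sum, map_smul, smul_eq_mul, hc]
    refine Finset.sum_congr rfl fun i _ => ?_
    rw [mul_comm]
  obtain ⟨σ, hσ⟩ := exists_perm_monovary (fun i => |c i|) fun i => |y i|
  have hz : WeakMaj x fun i => |y (σ i)| := fun s hs => (h s hs).trans_eq
    (Equiv.sum_comp σ fun i => max (|y i| - s) 0).symm
  have h1 := hz.sum_mul_le (fun i => abs_nonneg (c i)) (fun i => abs_nonneg _) hσ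
  set ε : Fin n → ℝ := fun i => if 0 ≤ c i * y (σ i) then 1 else -1 with hε
  have hε1 : ∀ i, |ε i| = 1 := by
    intro i
    simp only [hε]
    split_ifs <;> simp
  calc p x = ∑ i, c i * x i := by rw [← hℓx, hℓc]
    _ ≤ ∑ i, |c i| * x i :=
      Finset.sum_le_sum fun i _ => mul_le_mul_of_nonneg_right (le_abs_self _) (hx i)
    _ ≤ ∑ i, |c i| * |y (σ i)| := h1
    _ = ∑ i, c i * (ε i * y (σ i)) := by
      refine Finset.sum_congr rfl fun i _ => ?_
      rw [← abs_mul]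
      simp only [hε]
      split_ifs with hi
      · rw [abs_of_nonneg hi]; ring
      · rw [abs_of_neg (not_le.1 hi)]; ring
    _ = ℓ fun i => ε i * y (σ i) := (hℓc _).symm
    _ ≤ p fun i => ε i * y (σ i) := hℓ _
    _ = p y := by rw [hsign ε _ hε1, hperm]

section MatrixInequalities

open Matrix

variable {n : ℕ}

/-- The symmetric gauge function of a unitarily invariant norm: its restriction to real diagonal
matrices. -/
noncomputable def diagonalSeminorm (N : Seminorm ℂ (Matrix (Fin n) (Fin n) ℂ)) :
    Seminorm ℝ (Fin n → ℝ) :=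
  Seminorm.of (fun z => N (diagonal fun i => (z i : ℂ)))
    (fun z w => by
      have : (diagonal fun i => ((z + w) i : ℂ)) =
          (diagonal fun i => (z i : ℂ)) + diagonal fun i => (w i : ℂ) := by
        rw [diagonal_add]; simp
      rw [this]
      exact map_add_le_add N _ _)
    (fun c z => by
      have : (diagonal fun i => ((c • z) i : ℂ)) = (c : ℂ) • diagonal fun i => (z i : ℂ) := by
        rw [← diagonal_smul]; congr 1; ext i; simp
      rw [this, map_smul_eq_mul, Complex.norm_real])

lemma diagonalSeminorm_apply (N : Seminorm ℂ (Matrix (Fin n) (Fin n) ℂ)) (z : Fin n → ℝ) :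
    diagonalSeminorm N z = N (diagonal fun i => (z i : ℂ)) := rfl

lemma IsUnitarilyInvariantNorm.apply_cfc {N : Seminorm ℂ (Matrix (Fin n) (Fin n) ℂ)}
    (hN : IsUnitarilyInvariantNorm N) {A : Matrix (Fin n) (Fin n) ℂ} (hA : A.IsHermitian)
    (φ : ℝ → ℝ) : N (cfc φ A) = diagonalSeminorm N fun i => φ (hA.eigenvalues i) := by
  rw [hA.cfc_eq, IsHermitian.cfc, Unitary.conjStarAlgAut_apply, ← Unitary.coe_star,
    hN.invariant _ (SetLike.coe_mem _) _ (SetLike.coe_mem _)]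
  rfl

lemma IsUnitarilyInvariantNorm.apply_hermitian {N : Seminorm ℂ (Matrix (Fin n) (Fin n) ℂ)}
    (hN : IsUnitarilyInvariantNorm N) {A : Matrix (Fin n) (Fin n) ℂ} (hA : A.IsHermitian) :
    N A = diagonalSeminorm N hA.eigenvalues := by
  have hA' : IsSelfAdjoint A := hA
  conv_lhs => rw [← cfc_id ℝ A]
  exact hN.apply_cfc hA id

/-- **Ky Fan dominance**: a unitarily invariant norm is monotone for weak majorization of
absolute eigenvalues. -/
lemma IsUnitarilyInvariantNorm.diagonalSeminorm_le
    {N : Seminorm ℂ (Matrix (Fin n) (Fin n) ℂ)} (hN : IsUnitarilyInvariantNorm N)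
    {x y : Fin n → ℝ} (hx : ∀ i, 0 ≤ x i) (h : WeakMaj x fun i => |y i|) :
    diagonalSeminorm N x ≤ diagonalSeminorm N y := by
  refine h.seminorm_le _ (fun ε y hε => ?_) (fun σ y => ?_) hx
  · have hU : (diagonal fun i => (ε i : ℂ)) ∈ unitaryGroup (Fin n) ℂ := by
      rw [mem_unitaryGroup_iff, star_eq_conjTranspose, diagonal_conjTranspose,
        diagonal_mul_diagonal, ← diagonal_one]
      congr 1
      ext i
      have : ε i * ε i = 1 := by rw [← abs_mul_abs_self, hε i, one_mul]
      simp [← Complex.ofReal_mul, this]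
    have := hN.invariant _ hU 1 (one_mem _) (diagonal fun i => (y i : ℂ))
    rw [mul_one, diagonal_mul_diagonal] at this
    simpa only [diagonalSeminorm_apply, Complex.ofReal_mul] using this
  · have hU : ∀ τ : Equiv.Perm (Fin n), τ.permMatrix ℂ ∈ unitaryGroup (Fin n) ℂ := by
      intro τ
      rw [mem_unitaryGroup_iff, star_eq_conjTranspose, conjTranspose_permMatrix,
        ← permMatrix_mul]
      simp
    have := hN.invariant _ (hU σ) _ (hU σ⁻¹) (diagonal fun i => (y i : ℂ))
    rw [diagonalSeminorm_apply, diagonalSeminorm_apply, ← this]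
    congr 1
    ext i j
    simp [PEquiv.toMatrix_toPEquiv_mul, PEquiv.mul_toMatrix_toPEquiv, diagonal_apply,
      Equiv.Perm.inv_def]

end MatrixInequalities

/-! ### Inverses of concave functions and the norm inequalities -/

lemma ConvexOn.smul_le_of_map_zero {h : ℝ → ℝ} (hconv : ConvexOn ℝ (Set.Ici 0) h) (h0 : h 0 = 0)
    {θ r : ℝ} (hθ : 0 ≤ θ) (hθ1 : θ ≤ 1) (hr : 0 ≤ r) : h (θ * r) ≤ θ * h r := by
  have := hconv.2 (x := r) (y := 0) hr (le_refl (0 : ℝ)) hθ (sub_nonneg.2 hθ1) (by ring)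
  simpa [h0] using this

/-- The interval `[g 0, (g ∘ f)⁺ r]` lies in the domain of `g⁻¹`. -/
lemma GConvexOn.Icc_subset_image {J : Set ℝ} {f g : ℝ → ℝ} (hfg : GConvexOn (Set.Ici 0) J g f)
    (hgf0 : (g ∘ f) 0 ≤ 0) (h0J : (0 : ℝ) ∈ J) (hg0 : 0 ≤ g 0) {r : ℝ} (hr : 0 ≤ r) :
    Set.Icc (g 0) (max ((g ∘ f) r) 0) ⊆ g '' J := by
  rintro y ⟨hy0, hyr⟩
  rcases (hg0.trans hy0).eq_or_lt with rfl | hy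
  · exact ⟨0, h0J, le_antisymm hy0 hg0⟩
  set h : ℝ → ℝ := fun t => max ((g ∘ f) t) 0 with hh
  have hconv : ConvexOn ℝ (Set.Ici 0) h := hfg.convexOn.sup (convexOn_const 0 (convex_Ici 0))
  have hh0 : h 0 = 0 := max_eq_right hgf0
  have hhr : 0 < h r := hy.trans_le hyr
  have hr0 : 0 < r := hr.lt_of_ne fun e => by rw [← e, hh0] at hhr; exact hhr.false
  -- Convexity gives continuity on `(0, ∞)` only, so the intermediate value theorem is used on `[θ r, r]`.
  set θ := y / h r with hθ
  have hθ0 : 0 < θ := div_pos hy hhr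
  have hθ1 : θ ≤ 1 := (div_le_one hhr).2 hyr
  have h1 : h (θ * r) ≤ y := (hconv.smul_le_of_map_zero hh0 hθ0.le hθ1 hr).trans_eq
    (div_mul_cancel₀ y hhr.ne')
  have hcont : ContinuousOn h (Set.Icc (θ * r) r) :=
    ((hconv.subset Set.Ioi_subset_Ici_self (convex_Ioi 0)).continuousOn isOpen_Ioi).mono
      fun t ht => (mul_pos hθ0 hr0).trans_le ht.1
  obtain ⟨t, ht, hty⟩ := intermediate_value_Icc (mul_le_of_le_one_left hr hθ1) hcont ⟨h1, hyr⟩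
  have ht0 : 0 ≤ t := (mul_pos hθ0 hr0).le.trans ht.1
  refine ⟨f t, hfg.mapsTo ht0, ?_⟩
  simp only [hh] at hty
  rcases le_total ((g ∘ f) t) 0 with hle | hle
  · rw [max_eq_right hle] at hty; exact absurd hty hy.ne
  · rwa [max_eq_left hle] at hty

section InverseFunction

variable {J D : Set ℝ} {g : ℝ → ℝ}

lemma StrictMonoOn.monotoneOn_invFunOn (hg : StrictMonoOn g J) (hD : D ⊆ g '' J) :
    MonotoneOn (Function.invFunOn g J) D := by
  intro x hx y hy hxy
  rwa [← hg.le_iff_le (Function.invFunOn_mem (hD hx)) (Function.invFunOn_mem (hD hy)),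
    Function.invFunOn_eq (hD hx), Function.invFunOn_eq (hD hy)]

lemma ConcaveOn.convexOn_invFunOn (hc : ConcaveOn ℝ J g) (hg : StrictMonoOn g J)
    (hD : D ⊆ g '' J) (hDc : Convex ℝ D) : ConvexOn ℝ D (Function.invFunOn g J) := by
  refine ⟨hDc, fun x hx y hy a b ha hb hab => ?_⟩
  have hx' := Function.invFunOn_mem (hD hx)
  have hy' := Function.invFunOn_mem (hD hy)
  have hz := hD (hDc hx hy ha hb hab)
  rw [← hg.le_iff_le (Function.invFunOn_mem hz) (hc.1 hx' hy' ha hb hab), Function.invFunOn_eq hz]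
  have := hc.2 hx' hy' ha hb hab
  rwa [Function.invFunOn_eq (hD hx), Function.invFunOn_eq (hD hy)] at this

end InverseFunction

section MatrixInequalities

open scoped MatrixOrder
open Matrix

theorem mainTheorem9 {n : ℕ} (N : Seminorm ℂ (Matrix (Fin n) (Fin n) ℂ))
    (hN : IsUnitarilyInvariantNorm N)
    (A B : Matrix (Fin n) (Fin n) ℂ) (hA : A.PosSemidef) (hB : B.PosSemidef)
    (J : Set ℝ) (f g : ℝ → ℝ) (hfg : GConvexOn (Set.Ici 0) J g f)
    (hgf0 : (g ∘ f) 0 ≤ 0) (h0J : (0 : ℝ) ∈ J) (hg0 : 0 ≤ g 0)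
    (hfA : ∀ x ∈ spectrum ℝ A, 0 ≤ f x) (hfB : ∀ x ∈ spectrum ℝ B, 0 ≤ f x) :
    spectrum ℝ (cfc (g ∘ f) A + cfc (g ∘ f) B) ⊆ g '' J ∧
    N (cfc f A + cfc f B) ≤
      N (cfc (Function.invFunOn g J) (cfc (g ∘ f) A + cfc (g ∘ f) B)) ∧
    N (cfc (Function.invFunOn g J) (cfc (g ∘ f) A + cfc (g ∘ f) B)) ≤ N (cfc f (A + B)) := by
  have hS : (cfc (g ∘ f) A + cfc (g ∘ f) B).IsHermitian :=
    (isHermitian_cfc _ _).add (isHermitian_cfc _ _)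
  rcases isEmpty_or_nonempty (Fin n) with hn | hn
  · refine ⟨?_, le_of_eq (congrArg N (Subsingleton.elim _ _)),
      le_of_eq (congrArg N (Subsingleton.elim _ _))⟩
    rw [hS.spectrum_real_eq_range_eigenvalues, Set.range_eq_empty]
    exact Set.empty_subset _
  have hC : (A + B).IsHermitian := hA.1.add hB.1
  have hc0 : ∀ i, 0 ≤ hC.eigenvalues i := (hA.add hB).eigenvalues_nonneg
  obtain ⟨i₀, hi₀⟩ := Finite.exists_max hC.eigenvalues
  set r := hC.eigenvalues i₀
  have hr : 0 ≤ r := hc0 i₀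
  have hrspec : ∀ x ∈ spectrum ℝ (A + B), x ≤ r := (forall_mem_spectrum_iff hC).2 hi₀
  -- On the spectra of `A` and `B`, `g ∘ f ≥ g 0 ≥ 0` is its own positive part; on that of `A + B` it
  -- need not be.
  have hgf : ∀ {x}, 0 ≤ x → 0 ≤ f x → g 0 ≤ (g ∘ f) x := fun hx hfx =>
    hfg.strictMonoOn.monotoneOn h0J (hfg.mapsTo hx) hfx
  have hgA : ∀ x ∈ spectrum ℝ A, g 0 ≤ (g ∘ f) x := fun x hx =>
    hgf (spectrum_nonneg_of_nonneg hA.nonneg hx) (hfA x hx)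
  have hgB : ∀ x ∈ spectrum ℝ B, g 0 ≤ (g ∘ f) x := fun x hx =>
    hgf (spectrum_nonneg_of_nonneg hB.nonneg hx) (hfB x hx)
  set h : ℝ → ℝ := fun t => max ((g ∘ f) t) 0 with hh
  have hconv : ConvexOn ℝ (Set.Ici 0) h := hfg.convexOn.sup (convexOn_const 0 (convex_Ici 0))
  have hh0 : h 0 = 0 := max_eq_right hgf0
  have hhA : cfc h A = cfc (g ∘ f) A := cfc_congr fun x hx => max_eq_left (hg0.trans (hgA x hx))
  have hhB : cfc h B = cfc (g ∘ f) B := cfc_congr fun x hx => max_eq_left (hg0.trans (hgB x hx))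
  have hP : (cfc (g ∘ f) A).PosSemidef :=
    Matrix.nonneg_iff_posSemidef.1 (cfc_nonneg fun x hx => hg0.trans (hgA x hx))
  have hQ : (cfc (g ∘ f) B).PosSemidef :=
    Matrix.nonneg_iff_posSemidef.1 (cfc_nonneg fun x hx => hg0.trans (hgB x hx))
  have W1 : WeakMaj hS.eigenvalues fun i => h (hC.eigenvalues i) := by
    have key : ∀ X (hX : X.IsHermitian), cfc h A + cfc h B = X →
        WeakMaj hX.eigenvalues fun i => h (hC.eigenvalues i) := by
      rintro X hX rfl
      exact weakMaj_cfc_add hA hB (hconv.subset Set.Icc_subset_Ici_self (convex_Icc 0 r)) hh0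
        (fun t _ => le_max_right _ _) hrspec hX hC
    exact key _ hS (by rw [hhA, hhB])
  -- The spectrum of `g(f(A)) + g(f(B))` lies in `[g 0, h r]`.
  have hmono : ∀ i, h (hC.eigenvalues i) ≤ h r := by
    intro i
    rcases hr.eq_or_lt with e | hr'
    · rw [le_antisymm (hi₀ i) (e ▸ hc0 i)]
    · have hθ1 : hC.eigenvalues i / r ≤ 1 := (div_le_one hr').2 (hi₀ i)
      have := hconv.smul_le_of_map_zero hh0 (div_nonneg (hc0 i) hr) hθ1 hr
      rw [div_mul_cancel₀ _ hr'.ne'] at this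
      exact this.trans (mul_le_of_le_one_left (le_max_right _ _) hθ1)
  have hupper : ∀ i, hS.eigenvalues i ≤ h r := by
    intro i
    have h1 := W1 (h r) (le_max_right _ _)
    rw [Finset.sum_eq_zero fun j _ => max_eq_right (sub_nonpos.2 (hmono j))] at h1
    have h2 := (Finset.single_le_sum (f := fun j => max (hS.eigenvalues j - h r) 0)
      (fun j _ => le_max_right _ _) (Finset.mem_univ i)).trans h1
    linarith [le_max_left (hS.eigenvalues i - h r) 0]
  have hlower : ∀ i, g 0 ≤ hS.eigenvalues i := by
    have hA' : IsSelfAdjoint A := hA.1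
    have hS' : IsSelfAdjoint (cfc (g ∘ f) A + cfc (g ∘ f) B) := hS
    have h1 : algebraMap ℝ _ (g 0) ≤ cfc (g ∘ f) A + cfc (g ∘ f) B :=
      (algebraMap_le_cfc _ _ _ hgA (continuousOn_spectrum_matrix _ _)).trans
        (le_add_of_nonneg_right hQ.nonneg)
    exact (forall_mem_spectrum_iff hS).1 ((algebraMap_le_iff_le_spectrum (ha := hS')).1 h1)
  have hD : Set.Icc (g 0) (h r) ⊆ g '' J := hfg.Icc_subset_image hgf0 h0J hg0 hr
  have hSD : ∀ i, hS.eigenvalues i ∈ Set.Icc (g 0) (h r) := fun i => ⟨hlower i, hupper i⟩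
  have hgm : g 0 ≤ h r := (hlower i₀).trans (hupper i₀)
  -- The inverse of `g`, extended by `0` to the left of `g 0`, is again convex with value `0` at `0`.
  set G := Function.invFunOn g J with hG
  set φ : ℝ → ℝ := fun y => G (max y (g 0)) with hφ
  have hGg : ∀ u ∈ J, G (g u) = u := fun u hu => hfg.strictMonoOn.injOn.leftInvOn_invFunOn hu
  have hGmono : MonotoneOn G (Set.Icc (g 0) (h r)) := hfg.strictMonoOn.monotoneOn_invFunOn hD
  have hmax : ∀ y ∈ Set.Icc 0 (h r), max y (g 0) ∈ Set.Icc (g 0) (h r) := fun y hy =>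
    ⟨le_max_right _ _, max_le hy.2 hgm⟩
  have hφ0 : φ 0 = 0 := by simp only [hφ]; rw [max_eq_right hg0, hGg 0 h0J]
  have hφG : ∀ y, g 0 ≤ y → φ y = G y := fun y hy => by simp only [hφ]; rw [max_eq_left hy]
  have hφnn : ∀ y ∈ Set.Icc 0 (h r), 0 ≤ φ y := fun y hy => by
    rw [← hGg 0 h0J]
    exact hGmono ⟨le_rfl, hgm⟩ (hmax y hy) (le_max_right _ _)
  have hφconv : ConvexOn ℝ (Set.Icc 0 (h r)) φ := by
    have hGc := hfg.concaveOn.convexOn_invFunOn hfg.strictMonoOn hD (convex_Icc _ _)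
    refine ⟨convex_Icc _ _, fun x hx y hy a b ha hb hab => ?_⟩
    refine (hGmono (hmax _ (convex_Icc _ _ hx hy ha hb hab))
      (convex_Icc _ _ (hmax x hx) (hmax y hy) ha hb hab) ?_).trans
      (hGc.2 (hmax x hx) (hmax y hy) ha hb hab)
    exact ((convexOn_id convex_univ).sup (convexOn_const (g 0) convex_univ)).2
      (Set.mem_univ x) (Set.mem_univ y) ha hb hab
  have hSD0 : ∀ i, hS.eigenvalues i ∈ Set.Icc 0 (h r) := fun i =>
    ⟨hg0.trans (hlower i), hupper i⟩
  have hNG : N (cfc G (cfc (g ∘ f) A + cfc (g ∘ f) B)) =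
      diagonalSeminorm N fun i => φ (hS.eigenvalues i) := by
    rw [hN.apply_cfc hS]
    exact congrArg _ (funext fun i => (hφG _ (hlower i)).symm)
  refine ⟨?_, ?_, ?_⟩
  · rw [hS.spectrum_real_eq_range_eigenvalues]
    rintro _ ⟨i, rfl⟩
    exact hD (hSD i)
  · have comp : ∀ D : Matrix (Fin n) (Fin n) ℂ, D.PosSemidef → (∀ x ∈ spectrum ℝ D, 0 ≤ f x) →
        cfc φ (cfc (g ∘ f) D) = cfc f D := by
      intro D hD' hfD
      have hDs : IsSelfAdjoint D := hD'.1
      rw [← cfc_comp φ (g ∘ f) D hDs ((D.finite_real_spectrum.image _).continuousOn _)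
        (continuousOn_spectrum_matrix _ _)]
      refine cfc_congr fun x hx => ?_
      have hx0 := spectrum_nonneg_of_nonneg hD'.nonneg hx
      exact (hφG _ (hgf hx0 (hfD x hx))).trans (hGg _ (hfg.mapsTo hx0))
    have hX : (cfc φ (cfc (g ∘ f) A) + cfc φ (cfc (g ∘ f) B)).IsHermitian :=
      (isHermitian_cfc _ _).add (isHermitian_cfc _ _)
    have W2 := weakMaj_cfc_add hP hQ hφconv hφ0 hφnn ((forall_mem_spectrum_iff hS).2 hupper) hX hS
    have hX0 : (cfc φ (cfc (g ∘ f) A) + cfc φ (cfc (g ∘ f) B)).PosSemidef := by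
      rw [comp A hA hfA, comp B hB hfB]
      exact Matrix.nonneg_iff_posSemidef.1 (add_nonneg (cfc_nonneg hfA) (cfc_nonneg hfB))
    rw [hNG, ← comp A hA hfA, ← comp B hB hfB, hN.apply_hermitian hX]
    refine hN.diagonalSeminorm_le hX0.eigenvalues_nonneg fun s hs => (W2 s hs).trans_eq ?_
    exact Finset.sum_congr rfl fun i _ => by simp only [abs_of_nonneg (hφnn _ (hSD0 i))]
  · rw [hNG, hN.apply_cfc hC]
    have W3 := W1.comp_convexOn hφconv hφ0 hSD0 fun i => ⟨le_max_right _ _, hmono i⟩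
    refine hN.diagonalSeminorm_le (fun i => hφnn _ (hSD0 i)) fun s hs => (W3 s hs).trans ?_
    refine Finset.sum_le_sum fun i _ => max_le_max (sub_le_sub_right ?_ _) le_rfl
    change φ (h (hC.eigenvalues i)) ≤ |f (hC.eigenvalues i)|
    -- Where `g ∘ f ≤ g 0`, the left-hand side vanishes, but `f` may be negative.
    rcases le_total (g 0) ((g ∘ f) (hC.eigenvalues i)) with hle | hle
    · have : h (hC.eigenvalues i) = g (f (hC.eigenvalues i)) := max_eq_left (hg0.trans hle)
      rw [this, hφG (g (f (hC.eigenvalues i))) hle, hGg _ (hfg.mapsTo (hc0 i))]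
      exact le_abs_self _
    · have : φ (h (hC.eigenvalues i)) = 0 := by
        simp only [hφ]
        rw [max_eq_right (max_le hle hg0), hGg 0 h0J]
      rw [this]
      exact abs_nonneg _

end MatrixInequalities
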